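/- Let $B_\infty$ be the stationary triangular generalized Bratteli diagram with levels $V_n=\mathbb N=\{1,2,\dots\}$, $n=1,2,\dots$, in which there is exactly one edge from $i\in V_n$ to $j\in V_{n+1}$ if $i\le j$ and none otherwise (so every incidence matrix is lower triangular with all entries on and below the diagonal equal to $1$). Let $X_{B_\infty}$ be the space of infinite paths starting in $V_1$, with the topology generated by the cylinder sets $[\overline e]$ (all infinite paths that begin with the finite path $\overline e$; a path of length $0$ is a vertex of $V_1$). A Borel measure on $X_{B_\infty}$ is tail invariant if $[\overline e]$ and $[\overline e']$ have equal measure whenever $\overline e,\overline e'$ start in $V_1$ and end at the same vertex of the same level; it is ergodic if every Borel set that is a union of classes of the tail equivalence relation (two paths are equivalent if they coincide from some level on) is null or has null complement. For every $0<a<\infty$ there is exactly one Borel measure $\mu_a$ on $X_{B_\infty}$ such that $$\mu_a([\overline e])=\frac{a^{j-1}}{(1+a)^{n-1}(1+a)^{j}}$$ for every $n\ge 1$, every $j\in V_n$ and every finite path $\overline e$ from $V_1$ to $j\in V_n$. The family $\{\mu_a: 0<a<\infty\}$ is exactly the set of all ergodic non-atomic tail invariant Borel probability measures on $X_{B_\infty}$.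 -/

import Mathlib

open MeasureTheory

/-- A generalized Bratteli diagram: a graded graph with countably infinite levels `V 0, V 1, …`,
countable sets `E n` of edges from `V n` to `V (n + 1)`, source and range maps `s`, `r`, such that
every vertex emits an edge, every vertex outside `V 0` receives an edge, and every vertex receives
only finitely many edges. -/
structure GenBratteliDiagram where
  V : ℕ → Type
  E : ℕ → Type
  s : ∀ {n : ℕ}, E n → V n
  r : ∀ {n : ℕ}, E n → V (n + 1)
  countable_V : ∀ n, Countable (V n)
  infinite_V : ∀ n, Infinite (V n)
  countable_E : ∀ n, Countable (E n)
  exists_source : ∀ (n : ℕ) (v : V n), ∃ e : E n, s e = v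
  exists_range : ∀ (n : ℕ) (v : V (n + 1)), ∃ e : E n, r e = v
  finite_range : ∀ (n : ℕ) (v : V (n + 1)), {e : E n | r e = v}.Finite

namespace GenBratteliDiagram

/-- The path space `X_B`: infinite paths starting at level `0`. -/
def PathSpace (B : GenBratteliDiagram) : Type :=
  {x : ∀ n, B.E n // ∀ n, B.s (x (n + 1)) = B.r (x n)}

/-- Finite paths with `m` edges starting at level `0`, hence ending at level `m`. The initial
vertex is recorded so that for `m = 0` these are the vertices of level `0`. -/
structure FinPath (B : GenBratteliDiagram) (m : ℕ) where
  start : B.V 0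
  edge : ∀ i : Fin m, B.E i
  source_eq : ∀ h : 0 < m, B.s (edge ⟨0, h⟩) = start
  compat : ∀ (i : ℕ) (h : i + 1 < m),
    B.s (edge ⟨i + 1, h⟩) = B.r (edge ⟨i, Nat.lt_of_succ_lt h⟩)

/-- The terminal vertex of a finite path. -/
def FinPath.range {B : GenBratteliDiagram} : ∀ {m : ℕ}, B.FinPath m → B.V m
  | 0, e => e.start
  | m + 1, e => B.r (e.edge (Fin.last m))

/-- The cylinder set `[e]`: all infinite paths that begin with `e`. -/
def FinPath.cylinder {B : GenBratteliDiagram} {m : ℕ} (e : B.FinPath m) : Set B.PathSpace :=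
  {x | B.s (x.1 0) = e.start ∧ ∀ i : Fin m, x.1 i = e.edge i}

/-- The topology on the path space is generated by the cylinder sets. -/
instance (B : GenBratteliDiagram) : TopologicalSpace B.PathSpace :=
  TopologicalSpace.generateFrom {U | ∃ (m : ℕ) (e : B.FinPath m), U = e.cylinder}

instance (B : GenBratteliDiagram) : MeasurableSpace B.PathSpace := borel _

instance (B : GenBratteliDiagram) : BorelSpace B.PathSpace := ⟨rfl⟩

/-- Two infinite paths are tail equivalent if they coincide from some level on. -/
def TailEquiv (B : GenBratteliDiagram) (x y : B.PathSpace) : Prop :=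
  ∃ n : ℕ, ∀ i, n ≤ i → x.1 i = y.1 i

/-- A Borel measure is tail invariant if cylinder sets of finite paths with the same terminal
vertex have the same measure. -/
def TailInvariant (B : GenBratteliDiagram) (μ : Measure B.PathSpace) : Prop :=
  ∀ (m : ℕ) (e e' : B.FinPath m), e.range = e'.range → μ e.cylinder = μ e'.cylinder

/-- Ergodicity for the tail equivalence relation: every Borel set that is a union of tail
equivalence classes is null or conull. -/
def TailErgodic (B : GenBratteliDiagram) (μ : Measure B.PathSpace) : Prop :=
  ∀ A : Set B.PathSpace, MeasurableSet A →
    (∀ x y, B.TailEquiv x y → (x ∈ A ↔ y ∈ A)) → μ A = 0 ∨ μ Aᶜ = 0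

end GenBratteliDiagram

/-- The stationary triangular diagram `B_∞`: every level is `{1, 2, 3, …}` and there is exactly one
edge from the vertex `i` of a level to the vertex `j` of the next one if `i ≤ j`, and none
otherwise; thus every incidence matrix is lower triangular with all entries on and below the
diagonal equal to `1`. -/
def BInfty : GenBratteliDiagram where
  V _ := ℕ+
  E _ := {p : ℕ+ × ℕ+ // p.1 ≤ p.2}
  s e := e.1.1
  r e := e.1.2
  countable_V _ := inferInstance
  infinite_V _ := inferInstance
  countable_E _ := inferInstance
  exists_source _ v := ⟨⟨(v, v), le_rfl⟩, rfl⟩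
  exists_range _ v := ⟨⟨(v, v), le_rfl⟩, rfl⟩
  finite_range _ v := by
    refine Set.Finite.of_finite_image
      (f := fun e : {p : ℕ+ × ℕ+ // p.1 ≤ p.2} => e.1.1) ?_ ?_
    · refine (Set.finite_Iic v).subset ?_
      rintro _ ⟨e, he, rfl⟩
      exact e.2.trans (le_of_eq he)
    · intro e he f hf h
      exact Subtype.ext (Prod.ext h ((show e.1.2 = v from he).trans
        (show f.1.2 = v from hf).symm))

/-!
The ergodic measures are found from their extremality, without a limit theorem along paths.

The measure of a cylinder set of a path with `m` edges ending at `j` under a tail invariant measure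
depends on `m` and `j` only; call it `φ m j`. A path ending at `j` either stays at `j` in the next
step or moves up, and the continuations of the second kind correspond to those of a path of the same
length ending at `j + 1`, whence `φ m j = φ (m + 1) j + φ m (j + 1)` (`BInfty.cylMeasure_eq_add`).
Both `(m, j) ↦ φ (m + 1) j` and `(m, j) ↦ φ m (j + 1)` are the weights of tail invariant measures:
delete the first edge of the paths that start at `1`, respectively translate by `-1` the paths that
avoid `1`. So a tail invariant measure is the sum of these two. The only tail invariant measures
dominated by an ergodic one are its multiples (`GenBratteliDiagram.TailErgodic.eq_smul_of_le`): the density of a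
dominated tail invariant measure is a.e. invariant under the countably many maps exchanging two
prefixes with the same endpoint, and these maps generate tail equivalence. Hence
`φ m (j + 1) = c * φ m j` and `φ (m + 1) j = (1 - c) * φ m j`, and the total mass `1` gives
`φ m j = c ^ (j - 1) * (1 - c) ^ (m + 1)` with `c < 1`. If `c = 0` the measure is the point mass at
the vertical path through `1`; otherwise `a = c / (1 - c)`.

Conversely, the measure with these weights is the law of a path whose increments are independent
and geometrically distributed (`BInfty.geometricPathMeasure`). If `A` is a saturated Borel set, the
restriction to `A` is tail invariant, and the quotient of its weights by those of the full measure
is a bounded harmonic function for a Bernoulli walk on the quadrant. Such functions are constant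
(`BInfty.harmonic_eq_const`), so the restriction to `A` is a multiple of the full measure, which
forces `A` or its complement to be null.
-/

/-! ### Prefixes of paths and the Borel structure of the path space -/

namespace GenBratteliDiagram

variable {B : GenBratteliDiagram}

lemma FinPath.ext' {m : ℕ} {e f : B.FinPath m} (h₀ : e.start = f.start)
    (h : ∀ i, e.edge i = f.edge i) : e = f := by
  obtain ⟨_, ee, _, _⟩ := e
  obtain ⟨_, fe, _, _⟩ := f
  obtain rfl : ee = fe := funext h
  cases h₀
  rfl

/-- The finite path formed by the first `m` edges of an infinite path. -/
def PathSpace.take (m : ℕ) (x : B.PathSpace) : B.FinPath m where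
  start := B.s (x.1 0)
  edge i := x.1 i
  source_eq _ := rfl
  compat i _ := x.2 i

lemma PathSpace.range_take (m : ℕ) (x : B.PathSpace) : (x.take m).range = B.s (x.1 m) := by
  cases m with
  | zero => rfl
  | succ m => exact (x.2 m).symm

lemma FinPath.mem_cylinder {m : ℕ} {e : B.FinPath m} {x : B.PathSpace} :
    x ∈ e.cylinder ↔ x.take m = e :=
  ⟨fun h => FinPath.ext' h.1 h.2, by rintro rfl; exact ⟨rfl, fun _ => rfl⟩⟩

lemma PathSpace.take_eq_take_iff {m : ℕ} {x y : B.PathSpace} :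
    x.take m = y.take m ↔ B.s (x.1 0) = B.s (y.1 0) ∧ ∀ i < m, x.1 i = y.1 i :=
  ⟨fun h => ⟨congrArg FinPath.start h, fun i hi => congrArg (fun e => e.edge ⟨i, hi⟩) h⟩,
    fun h => FinPath.ext' h.1 fun i => h.2 i i.2⟩

lemma PathSpace.take_eq_take_of_le {k m : ℕ} (hkm : k ≤ m) {x y : B.PathSpace}
    (h : x.take m = y.take m) : x.take k = y.take k := by
  rw [take_eq_take_iff] at h ⊢
  exact ⟨h.1, fun i hi => h.2 i (hi.trans_le hkm)⟩

instance (B : GenBratteliDiagram) (m : ℕ) : Countable (B.FinPath m) := by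
  have := B.countable_V
  have := B.countable_E
  refine Function.Injective.countable
    (f := fun e : B.FinPath m => ((e.start, e.edge) : B.V 0 × ∀ i : Fin m, B.E i)) ?_
  intro e f h
  exact FinPath.ext' (congrArg Prod.fst h) (congrFun (congrArg Prod.snd h))

/-- The cylinder sets. -/
def cylinders (B : GenBratteliDiagram) : Set (Set B.PathSpace) :=
  {U | ∃ (m : ℕ) (e : B.FinPath m), U = e.cylinder}

lemma countable_cylinders (B : GenBratteliDiagram) : B.cylinders.Countable := by
  have : B.cylinders = ⋃ m : ℕ, Set.range fun e : B.FinPath m => e.cylinder := by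
    ext U
    simp [cylinders, eq_comm]
  rw [this]
  exact Set.countable_iUnion fun m => Set.countable_range _

lemma borel_eq_generateFrom_cylinders (B : GenBratteliDiagram) :
    instMeasurableSpacePathSpace B =
      MeasurableSpace.generateFrom B.cylinders := by
  have : SecondCountableTopology B.PathSpace := ⟨⟨B.cylinders, B.countable_cylinders, rfl⟩⟩
  exact borel_eq_generateFrom_of_subbasis rfl

/-- Two cylinder sets are nested or disjoint. -/
lemma isPiSystem_cylinders (B : GenBratteliDiagram) : IsPiSystem B.cylinders := by
  rintro _ ⟨m, e, rfl⟩ _ ⟨k, f, rfl⟩ ⟨x, hxe, hxf⟩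
  rw [FinPath.mem_cylinder] at hxe hxf
  subst hxe hxf
  rcases le_total m k with h | h
  · refine ⟨k, x.take k, Set.inter_eq_right.2 fun y hy => ?_⟩
    rw [FinPath.mem_cylinder] at hy ⊢
    exact PathSpace.take_eq_take_of_le h hy
  · refine ⟨m, x.take m, Set.inter_eq_left.2 fun y hy => ?_⟩
    rw [FinPath.mem_cylinder] at hy ⊢
    exact PathSpace.take_eq_take_of_le h hy

lemma FinPath.measurableSet_cylinder {m : ℕ} (e : B.FinPath m) : MeasurableSet e.cylinder :=
  have h : IsOpen e.cylinder :=
    TopologicalSpace.isOpen_generateFrom_of_mem (g := B.cylinders) ⟨m, e, rfl⟩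
  h.measurableSet

lemma measurable_of_take {Y : Type*} [MeasurableSpace Y] {f : Y → B.PathSpace}
    (h : ∀ (m : ℕ) (e : B.FinPath m), MeasurableSet {y | (f y).take m = e}) : Measurable f := by
  rw [borel_eq_generateFrom_cylinders B]
  refine measurable_generateFrom ?_
  rintro _ ⟨m, e, rfl⟩
  convert h m e using 1
  ext y
  exact FinPath.mem_cylinder

/-- A property of a path depending only on a prefix of fixed length is measurable, since there
are only countably many finite paths. -/
lemma measurableSet_of_take (m : ℕ) (P : B.PathSpace → Prop)
    (h : ∀ x y : B.PathSpace, x.take m = y.take m → P x → P y) : MeasurableSet {x | P x} := by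
  have : {x | P x} = ⋃ e : {e : B.FinPath m // ∃ x, P x ∧ x.take m = e}, e.1.cylinder := by
    ext x
    simp only [Set.mem_iUnion, FinPath.mem_cylinder, Set.mem_ofPred_eq]
    constructor
    · exact fun hx => ⟨⟨_, x, hx, rfl⟩, rfl⟩
    · rintro ⟨⟨_, y, hy, rfl⟩, hx⟩
      exact h y x hx.symm hy
  rw [this]
  exact MeasurableSet.iUnion fun e => e.1.measurableSet_cylinder

lemma measure_ext_of_cylinder {μ ν : Measure B.PathSpace}
    (hfin : ∀ e : B.FinPath 0, μ e.cylinder ≠ ⊤)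
    (h : ∀ (m : ℕ) (e : B.FinPath m), μ e.cylinder = ν e.cylinder) : μ = ν := by
  refine Measure.ext_of_generateFrom_of_cover_subset (S := B.cylinders)
    (T := Set.range fun e : B.FinPath 0 => e.cylinder)
    B.borel_eq_generateFrom_cylinders B.isPiSystem_cylinders ?_ (Set.countable_range _) ?_ ?_ ?_
  · rintro _ ⟨e, rfl⟩
    exact ⟨0, e, rfl⟩
  · refine Set.eq_univ_of_forall fun x => ⟨_, ⟨x.take 0, rfl⟩, FinPath.mem_cylinder.2 rfl⟩
  · rintro _ ⟨e, rfl⟩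
    exact hfin e
  · rintro _ ⟨m, e, rfl⟩
    exact h m e

/-! ### Exchanging prefixes -/

open Classical in
/-- The path obtained from `x` by replacing its first `m` edges with those of `e`. If `e` does not
end at the vertex through which `x` passes at level `m`, the value is `x` itself. -/
noncomputable def FinPath.splice {m : ℕ} (e : B.FinPath m) (x : B.PathSpace) : B.PathSpace :=
  if h : B.s (x.1 m) = e.range then
    ⟨fun n => if hn : n < m then e.edge ⟨n, hn⟩ else x.1 n, fun n => by
      rcases lt_trichotomy (n + 1) m with hn | rfl | hn
      · simp only [hn, dif_pos, n.lt_succ_self.trans hn]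
        exact e.compat n hn
      · simp only [lt_irrefl, n.lt_succ_self, dif_pos, dif_neg, not_false_iff]
        exact h
      · simp only [show ¬ n + 1 < m by omega, show ¬ n < m by omega, dif_neg, not_false_iff]
        exact x.2 n⟩
  else x

lemma FinPath.splice_of_ne {m : ℕ} {e : B.FinPath m} {x : B.PathSpace}
    (h : B.s (x.1 m) ≠ e.range) : e.splice x = x :=
  dif_neg h

lemma FinPath.splice_of_lt {m : ℕ} {e : B.FinPath m} {x : B.PathSpace}
    (h : B.s (x.1 m) = e.range) {n : ℕ} (hn : n < m) : (e.splice x).1 n = e.edge ⟨n, hn⟩ := by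
  simp [splice, h, hn]

lemma FinPath.splice_of_le {m : ℕ} (e : B.FinPath m) (x : B.PathSpace) {n : ℕ} (hn : m ≤ n) :
    (e.splice x).1 n = x.1 n := by
  by_cases h : B.s (x.1 m) = e.range
  · simp [splice, h, hn.not_gt]
  · rw [splice_of_ne h]

lemma FinPath.take_splice {m : ℕ} {e : B.FinPath m} {x : B.PathSpace}
    (h : B.s (x.1 m) = e.range) : (e.splice x).take m = e := by
  refine FinPath.ext' ?_ fun i => splice_of_lt h i.2
  change B.s ((e.splice x).1 0) = e.start
  rcases Nat.eq_zero_or_pos m with rfl | hm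
  · rw [splice_of_le e x le_rfl, h]
    rfl
  · rw [splice_of_lt h hm, e.source_eq]

lemma FinPath.take_splice_eq_take_splice {m k : ℕ} {e : B.FinPath m}
    {x y : B.PathSpace} (hx : B.s (x.1 m) = e.range) (hy : B.s (y.1 m) = e.range)
    (h : ∀ i, m ≤ i → i < k → x.1 i = y.1 i) :
    (e.splice x).take k = (e.splice y).take k := by
  have h' := (take_splice hx).trans (take_splice hy).symm
  rw [PathSpace.take_eq_take_iff] at h' ⊢
  refine ⟨h'.1, fun i hi => ?_⟩
  rcases lt_or_ge i m with him | him
  · exact h'.2 i him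
  · rw [splice_of_le _ _ him, splice_of_le _ _ him, h i him hi]

lemma PathSpace.eq_of_take_of_le {m : ℕ} {x y : B.PathSpace} (h : x.take m = y.take m)
    (h' : ∀ i, m ≤ i → x.1 i = y.1 i) : x = y := by
  refine Subtype.ext (funext fun i => ?_)
  rcases lt_or_ge i m with him | him
  · exact (take_eq_take_iff.1 h).2 i him
  · exact h' i him

lemma FinPath.splice_splice {m : ℕ} {e e' : B.FinPath m} {x : B.PathSpace}
    (hx : x.take m = e) : e.splice (e'.splice x) = x := by
  have h : B.s (x.1 m) = e.range := by rw [← hx, PathSpace.range_take]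
  refine PathSpace.eq_of_take_of_le (m := m) ?_ fun i hi => ?_
  · rw [hx, take_splice]
    rw [splice_of_le _ _ le_rfl, h]
  · rw [splice_of_le _ _ hi, splice_of_le _ _ hi]

lemma FinPath.tailEquiv_splice {m : ℕ} (e : B.FinPath m) (x : B.PathSpace) :
    B.TailEquiv x (e.splice x) :=
  ⟨m, fun _ hi => (e.splice_of_le x hi).symm⟩

/-- Tail equivalent paths differ by an exchange of prefixes. -/
lemma TailEquiv.exists_splice {x y : B.PathSpace} (h : B.TailEquiv x y) :
    ∃ m, (x.take m).range = (y.take m).range ∧ (y.take m).splice x = y := by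
  obtain ⟨m, hm⟩ := h
  have hs : B.s (x.1 m) = (y.take m).range := by rw [PathSpace.range_take, hm m le_rfl]
  refine ⟨m, by rw [PathSpace.range_take, hs], PathSpace.eq_of_take_of_le (m := m) ?_ ?_⟩
  · exact FinPath.take_splice hs
  · intro i hi
    rw [FinPath.splice_of_le _ _ hi, hm i hi]

lemma FinPath.measurable_splice {m : ℕ} (e : B.FinPath m) : Measurable e.splice := by
  refine measurable_of_take fun k f => measurableSet_of_take (max k m + 1) _ fun x y hxy h => ?_
  rw [← h]
  have hi := (PathSpace.take_eq_take_iff.1 hxy).2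
  rcases le_total m k with hmk | hmk
  all_goals
    by_cases hx : B.s (x.1 m) = e.range
    · have hy : B.s (y.1 m) = e.range := by rw [← hi m (by omega), hx]
      refine PathSpace.take_eq_take_of_le (m := max k m) (le_max_left _ _) ?_
      exact take_splice_eq_take_splice hy hx fun i _ hik =>
        (hi i (by omega)).symm
    · have hy : ¬ B.s (y.1 m) = e.range := by rwa [← hi m (by omega)]
      rw [splice_of_ne hx, splice_of_ne hy]
      exact (PathSpace.take_eq_take_of_le (by omega) hxy).symm

/-- Exchanging two prefixes with the same terminal vertex preserves a tail invariant measure. -/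
theorem TailInvariant.map_splice {μ : Measure B.PathSpace} [IsFiniteMeasure μ]
    (hμ : B.TailInvariant μ) {m : ℕ} {e e' : B.FinPath m} (hee : e.range = e'.range) :
    (μ.restrict e.cylinder).map e'.splice = μ.restrict e'.cylinder := by
  refine measure_ext_of_cylinder (fun _ => measure_ne_top _ _) fun k f => ?_
  rw [Measure.map_apply e'.measurable_splice f.measurableSet_cylinder,
    Measure.restrict_apply (e'.measurable_splice f.measurableSet_cylinder),
    Measure.restrict_apply f.measurableSet_cylinder]
  have hr : ∀ {x : B.PathSpace} {g : B.FinPath m}, x ∈ g.cylinder → B.s (x.1 m) = g.range := by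
    intro x g hx
    rw [← FinPath.mem_cylinder.1 hx, PathSpace.range_take]
  have hmap : ∀ x ∈ e.cylinder, e'.splice x ∈ e'.cylinder := fun x hx =>
    FinPath.mem_cylinder.2 (FinPath.take_splice ((hr hx).trans hee))
  rcases (f.cylinder ∩ e'.cylinder).eq_empty_or_nonempty with h | ⟨p, hpf, hpe⟩
  · have : e'.splice ⁻¹' f.cylinder ∩ e.cylinder = ∅ := by
      refine Set.eq_empty_of_forall_notMem fun x hx => ?_
      have : e'.splice x ∈ f.cylinder ∩ e'.cylinder := ⟨hx.1, hmap x hx.2⟩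
      rwa [h] at this
    rw [h, this]
  · -- Both sets are cylinders, determined by a common path `p` and its image under the exchange.
    have hp := FinPath.mem_cylinder.1 hpe
    have hps : B.s (p.1 m) = e.range := (hr hpe).trans hee.symm
    have h₁ : f.cylinder ∩ e'.cylinder = (p.take (max k m)).cylinder := by
      ext y
      rw [Set.mem_inter_iff, FinPath.mem_cylinder, FinPath.mem_cylinder, FinPath.mem_cylinder,
        ← hp, ← FinPath.mem_cylinder.1 hpf]
      constructor
      · rintro ⟨h₁, h₂⟩
        rcases le_total k m with h | h
        · rwa [max_eq_right h]
        · rwa [max_eq_left h]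
      · exact fun h => ⟨PathSpace.take_eq_take_of_le (le_max_left _ _) h,
          PathSpace.take_eq_take_of_le (le_max_right _ _) h⟩
    have h₂ : e'.splice ⁻¹' f.cylinder ∩ e.cylinder =
        ((e.splice p).take (max k m)).cylinder := by
      ext y
      constructor
      · rintro ⟨hy₁, hy₂⟩
        have hy : e'.splice y ∈ (p.take (max k m)).cylinder := h₁ ▸ ⟨hy₁, hmap y hy₂⟩
        rw [FinPath.mem_cylinder] at hy ⊢
        rw [← FinPath.splice_splice (FinPath.mem_cylinder.1 hy₂)]
        refine FinPath.take_splice_eq_take_splice ?_ hps fun i _ hi =>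
          (PathSpace.take_eq_take_iff.1 hy).2 i hi
        rw [FinPath.splice_of_le _ _ le_rfl, hr hy₂]
      · intro hy
        rw [FinPath.mem_cylinder] at hy
        have hye : y ∈ e.cylinder := by
          rw [FinPath.mem_cylinder, ← FinPath.take_splice hps]
          exact PathSpace.take_eq_take_of_le (le_max_right _ _) hy
        refine ⟨?_, hye⟩
        suffices e'.splice y ∈ f.cylinder ∩ e'.cylinder from this.1
        rw [h₁, FinPath.mem_cylinder, ← FinPath.splice_splice hp]
        refine FinPath.take_splice_eq_take_splice ((hr hye).trans hee) ?_
          fun i _ hi => (PathSpace.take_eq_take_iff.1 hy).2 i hi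
        rw [FinPath.splice_of_le _ _ le_rfl, hr hpe]
    rw [h₁, h₂]
    refine hμ _ _ _ ?_
    rw [PathSpace.range_take, PathSpace.range_take, FinPath.splice_of_le _ _ (le_max_right _ _)]

/-- The restriction of a tail invariant measure to a tail saturated set is tail invariant. -/
theorem TailInvariant.restrict {μ : Measure B.PathSpace} [IsFiniteMeasure μ]
    (hμ : B.TailInvariant μ) {A : Set B.PathSpace} (hA : MeasurableSet A)
    (hsat : ∀ x y, B.TailEquiv x y → (x ∈ A ↔ y ∈ A)) : B.TailInvariant (μ.restrict A) := by
  intro m e e' hee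
  rw [Measure.restrict_apply e.measurableSet_cylinder,
    Measure.restrict_apply e'.measurableSet_cylinder, Set.inter_comm _ A, Set.inter_comm _ A,
    ← Measure.restrict_apply hA, ← Measure.restrict_apply hA, ← hμ.map_splice hee,
    Measure.map_apply e'.measurable_splice hA]
  congr 1
  ext x
  exact hsat _ _ (e'.tailEquiv_splice x)

/-! ### Extremality of ergodic measures -/

/-- The density of one tail invariant measure with respect to another is invariant under the
exchange of prefixes. -/
lemma TailInvariant.rnDeriv_splice {μ ν : Measure B.PathSpace} [IsFiniteMeasure μ]
    [IsFiniteMeasure ν] (hμ : B.TailInvariant μ) (hν : B.TailInvariant ν) (hμν : μ ≪ ν)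
    {m : ℕ} {e e' : B.FinPath m} (hee : e.range = e'.range) :
    ∀ᵐ x ∂ν, x ∈ e.cylinder → μ.rnDeriv ν (e'.splice x) = μ.rnDeriv ν x := by
  rw [← ae_restrict_iff' e.measurableSet_cylinder]
  have hg := Measure.measurable_rnDeriv μ ν
  refine ae_eq_of_forall_setLIntegral_eq_of_sigmaFinite (hg.comp e'.measurable_splice) hg
    fun A hA _ => ?_
  rw [Measure.restrict_restrict hA, Measure.setLIntegral_rnDeriv hμν]
  have hA' : MeasurableSet (e.splice ⁻¹' A) := e.measurable_splice hA
  have hset : e'.splice ⁻¹' (e.splice ⁻¹' A) ∩ e.cylinder = A ∩ e.cylinder := by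
    ext x
    refine and_congr_left fun hx => ?_
    rw [Set.mem_preimage, Set.mem_preimage, FinPath.splice_splice (FinPath.mem_cylinder.1 hx)]
  calc ∫⁻ x in A ∩ e.cylinder, μ.rnDeriv ν (e'.splice x) ∂ν
      = ∫⁻ x in e'.splice ⁻¹' (e.splice ⁻¹' A), μ.rnDeriv ν (e'.splice x)
          ∂(ν.restrict e.cylinder) := by
        rw [Measure.restrict_restrict (e'.measurable_splice hA'), hset]
    _ = ∫⁻ y in e.splice ⁻¹' A, μ.rnDeriv ν y ∂(ν.restrict e'.cylinder) := by
        rw [← hν.map_splice hee, setLIntegral_map hA' hg e'.measurable_splice]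
    _ = μ.restrict e'.cylinder (e.splice ⁻¹' A) := by
        rw [Measure.restrict_restrict hA', Measure.setLIntegral_rnDeriv hμν,
          Measure.restrict_apply hA']
    _ = μ (A ∩ e.cylinder) := by
        rw [← hμ.map_splice hee, Measure.map_apply e'.measurable_splice hA',
          Measure.restrict_apply (e'.measurable_splice hA'), hset]

/-- An ergodic tail invariant measure is extremal: the tail invariant measures that it dominates
are its multiples. The density of a dominated measure is almost everywhere invariant under the countably many exchanges
of prefixes; these generate tail equivalence, so its level sets agree almost everywhere with
saturated ones. -/
theorem TailErgodic.eq_smul_of_le {μ ν : Measure B.PathSpace} [IsFiniteMeasure ν]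
    (herg : B.TailErgodic ν) (hν : B.TailInvariant ν) (hμ : B.TailInvariant μ) (hle : μ ≤ ν) :
    ∃ c : ENNReal, μ = c • ν := by
  have : IsFiniteMeasure μ := isFiniteMeasure_of_le ν hle
  have hac : μ ≪ ν := Measure.absolutelyContinuous_of_le hle
  set g := μ.rnDeriv ν
  have hg : Measurable g := Measure.measurable_rnDeriv μ ν
  have hinv : ∀ᵐ x ∂ν, ∀ (m : ℕ) (e e' : B.FinPath m), e.range = e'.range → x ∈ e.cylinder →
      g (e'.splice x) = g x := by
    simp only [ae_all_iff]
    exact fun m e e' hee => hμ.rnDeriv_splice hν hac hee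
  have hconst : ∃ c, g =ᵐ[ν] Function.const _ c := by
    refine Filter.exists_eventuallyEq_const_of_forall_separating MeasurableSet fun U hU => ?_
    -- the largest saturated subset of `g ⁻¹' U`
    set A : Set B.PathSpace := {x | ∀ (m : ℕ) (e e' : B.FinPath m), e.range = e'.range →
      x ∈ e.cylinder → g (e'.splice x) ∈ U} with hAdef
    have hAm : MeasurableSet A := by
      simp only [hAdef, Set.ofPred_forall]
      refine MeasurableSet.iInter fun m => MeasurableSet.iInter fun e =>
        MeasurableSet.iInter fun e' => MeasurableSet.iInter fun _ => ?_
      exact e.measurableSet_cylinder.imp (hg.comp e'.measurable_splice hU)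
    have hAmem : ∀ x, x ∈ A ↔ ∀ y, B.TailEquiv x y → g y ∈ U := by
      intro x
      constructor
      · intro hx y hxy
        obtain ⟨m, h₁, h₂⟩ := hxy.exists_splice
        exact h₂ ▸ hx m _ _ h₁ (FinPath.mem_cylinder.2 rfl)
      · exact fun h m e e' _ _ => h _ (e'.tailEquiv_splice x)
    have hAsat : ∀ x y, B.TailEquiv x y → (x ∈ A ↔ y ∈ A) := by
      have htrans : ∀ {x y z}, B.TailEquiv x y → B.TailEquiv y z → B.TailEquiv x z := by
        rintro x y z ⟨m, hm⟩ ⟨n, hn⟩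
        exact ⟨max m n, fun i hi => (hm i ((le_max_left _ _).trans hi)).trans
          (hn i ((le_max_right _ _).trans hi))⟩
      have hsymm : ∀ {x y}, B.TailEquiv x y → B.TailEquiv y x :=
        fun ⟨m, hm⟩ => ⟨m, fun i hi => (hm i hi).symm⟩
      intro x y hxy
      rw [hAmem, hAmem]
      exact ⟨fun h z hz => h z (htrans hxy hz), fun h z hz => h z (htrans (hsymm hxy) hz)⟩
    have hAU : ∀ᵐ x ∂ν, x ∈ A ↔ g x ∈ U := by
      filter_upwards [hinv] with x hx
      refine ⟨fun h => (hAmem x).1 h x ⟨0, fun _ _ => rfl⟩, fun h m e e' hee hxe => ?_⟩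
      rwa [hx m e e' hee hxe]
    rcases herg A hAm hAsat with h | h
    · right
      filter_upwards [hAU, measure_eq_zero_iff_ae_notMem.1 h] with x hx hxA
      rwa [← hx]
    · left
      filter_upwards [hAU, measure_eq_zero_iff_ae_notMem.1 h] with x hx hxA
      exact hx.1 (not_not.1 hxA)
  obtain ⟨c, hc⟩ := hconst
  refine ⟨c, ?_⟩
  rw [← Measure.withDensity_rnDeriv_eq μ ν hac, withDensity_congr_ae hc]
  exact withDensity_const c

end GenBratteliDiagram

/-! ### Paths of the diagram as nondecreasing sequences of vertices -/

namespace BInfty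

open GenBratteliDiagram

/-- The terminal vertex of a finite path, as a positive integer. -/
def endpoint {m : ℕ} (e : BInfty.FinPath m) : ℕ+ := e.range

/-- The vertex of level `n` on an infinite path. -/
def vertex (x : BInfty.PathSpace) (n : ℕ) : ℕ+ := BInfty.s (x.1 n)

/-- The infinite path through a nondecreasing sequence of vertices. -/
def ofMonotone (j : ℕ → ℕ+) (hj : Monotone j) : BInfty.PathSpace :=
  ⟨fun n => ⟨(j n, j (n + 1)), hj n.le_succ⟩, fun _ => rfl⟩

/-- The vertical path through the vertex `j` of each level. -/
def constPath (j : ℕ+) : BInfty.PathSpace := ofMonotone (fun _ => j) monotone_const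

lemma vertex_constPath (j : ℕ+) (n : ℕ) : vertex (constPath j) n = j := rfl

lemma edge_eq (x : BInfty.PathSpace) (n : ℕ) : (x.1 n).1 = (vertex x n, vertex x (n + 1)) :=
  Prod.ext rfl (x.2 n).symm

lemma monotone_vertex (x : BInfty.PathSpace) : Monotone (vertex x) := by
  refine monotone_nat_of_le_succ fun n => ?_
  have h := (x.1 n).2
  rwa [edge_eq] at h

lemma endpoint_take (m : ℕ) (x : BInfty.PathSpace) : endpoint (x.take m) = vertex x m :=
  x.range_take m

lemma take_eq_take_iff {m : ℕ} {x y : BInfty.PathSpace} :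
    x.take m = y.take m ↔ ∀ i ≤ m, vertex x i = vertex y i := by
  rw [PathSpace.take_eq_take_iff]
  constructor
  · rintro ⟨h₀, h⟩ i hi
    cases i with
    | zero => exact h₀
    | succ i =>
      have := congrArg Subtype.val (h i hi)
      rw [edge_eq, edge_eq] at this
      exact congrArg Prod.snd this
  · refine fun h => ⟨h 0 (Nat.zero_le _), fun i hi => Subtype.ext ?_⟩
    rw [edge_eq, edge_eq, h i hi.le, h (i + 1) hi]

lemma exists_take_eq {m : ℕ} (e : BInfty.FinPath m) : ∃ x : BInfty.PathSpace, x.take m = e :=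
  ⟨e.splice (constPath e.range), FinPath.take_splice rfl⟩

lemma mem_cylinder_take {m : ℕ} {x y : BInfty.PathSpace} :
    y ∈ (x.take m).cylinder ↔ ∀ i ≤ m, vertex y i = vertex x i := by
  rw [FinPath.mem_cylinder, take_eq_take_iff]

lemma measurableSet_vertex (n : ℕ) (P : ℕ+ → Prop) :
    MeasurableSet {x : BInfty.PathSpace | P (vertex x n)} :=
  measurableSet_of_take n _ fun x y h hx => by rwa [← take_eq_take_iff.1 h n le_rfl]

/-! ### Cylinder weights of tail invariant measures -/

/-- The measure of a cylinder set of a path with `m` edges ending at `j`; the representative is the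
vertical path, and for a tail invariant measure the choice does not matter. -/
noncomputable def cylMeasure (ν : Measure BInfty.PathSpace) (m : ℕ) (j : ℕ+) : ENNReal :=
  ν ((constPath j).take m).cylinder

lemma measure_cylinder {ν : Measure BInfty.PathSpace} (hν : BInfty.TailInvariant ν) {m : ℕ}
    (e : BInfty.FinPath m) : ν e.cylinder = cylMeasure ν m (endpoint e) :=
  hν _ _ _ (endpoint_take m (constPath (endpoint e))).symm

lemma tailInvariant_of_measure_cylinder {ν : Measure BInfty.PathSpace} (f : ℕ → ℕ+ → ENNReal)
    (h : ∀ (m : ℕ) (e : BInfty.FinPath m), ν e.cylinder = f m (endpoint e)) :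
    BInfty.TailInvariant ν := by
  intro m e e' hee
  rw [h, h]
  exact congrArg (f m) hee

lemma cylMeasure_of_measure_cylinder {ν : Measure BInfty.PathSpace} {f : ℕ → ℕ+ → ENNReal}
    (h : ∀ (m : ℕ) (e : BInfty.FinPath m), ν e.cylinder = f m (endpoint e)) (m : ℕ) (j : ℕ+) :
    cylMeasure ν m j = f m j := by
  rw [cylMeasure, h, endpoint_take, vertex_constPath]

lemma tsum_cylMeasure_zero (ν : Measure BInfty.PathSpace) :
    ∑' j, cylMeasure ν 0 j = ν Set.univ := by
  have hunion : (Set.univ : Set BInfty.PathSpace) = ⋃ j, ((constPath j).take 0).cylinder := by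
    refine (Set.eq_univ_of_forall fun x => Set.mem_iUnion.2 ⟨vertex x 0, ?_⟩).symm
    rw [mem_cylinder_take]
    intro i hi
    rw [Nat.le_zero.1 hi, vertex_constPath]
  rw [hunion, measure_iUnion _ fun j => FinPath.measurableSet_cylinder _]
  · rfl
  · intro j k hjk
    refine Set.disjoint_left.2 fun x hx hx' => hjk ?_
    rw [mem_cylinder_take] at hx hx'
    exact (hx 0 le_rfl).symm.trans (hx' 0 le_rfl)

/-- The Chapman–Kolmogorov relation for the weights of a tail invariant measure. -/
lemma cylMeasure_eq_tsum {ν : Measure BInfty.PathSpace} (hν : BInfty.TailInvariant ν) (m : ℕ)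
    (j : ℕ+) : cylMeasure ν m j = ∑' k, if j ≤ k then cylMeasure ν (m + 1) k else 0 := by
  set C := ((constPath j).take m).cylinder
  have hunion : C = ⋃ k, C ∩ {x | vertex x (m + 1) = k} := by
    ext x
    simp
  rw [show cylMeasure ν m j = ν C from rfl, hunion, measure_iUnion]
  · refine tsum_congr fun k => ?_
    split_ifs with hjk
    · -- the path that stays at `j` up to level `m` and then moves to `k`
      set p := ofMonotone (fun i => if i ≤ m then j else k) (by
        intro i i' hi
        dsimp only
        split_ifs
        · exact le_rfl
        · exact hjk
        · omega
        · exact le_rfl)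
      have hp : C ∩ {x | vertex x (m + 1) = k} = (p.take (m + 1)).cylinder := by
        ext x
        rw [mem_cylinder_take, Set.mem_inter_iff, mem_cylinder_take]
        constructor
        · rintro ⟨h, h'⟩ i hi
          rcases Nat.le_succ_iff.1 hi with him | rfl
          · rw [h i him]
            exact (if_pos him).symm
          · exact h'.trans (if_neg (by omega)).symm
        · intro h
          exact ⟨fun i hi => (h i (by omega)).trans (if_pos hi),
            (h (m + 1) le_rfl).trans (if_neg (by omega))⟩
      rw [hp, measure_cylinder hν, endpoint_take]
      exact congrArg _ (if_neg (by omega))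
    · convert measure_empty (μ := ν)
      refine Set.eq_empty_of_forall_notMem fun x hx => hjk ?_
      have h := mem_cylinder_take.1 hx.1 m le_rfl
      rw [vertex_constPath] at h
      rw [← h, ← show vertex x (m + 1) = k from hx.2]
      exact monotone_vertex x m.le_succ
  · intro k k' hkk
    refine Set.disjoint_left.2 fun x hx hx' => hkk ?_
    exact (show vertex x (m + 1) = k from hx.2).symm.trans hx'.2
  · exact fun k => (FinPath.measurableSet_cylinder _).inter (measurableSet_vertex _ (· = k))

/-- A path of length `m` ending at `j` either stays at `j` in the next step or moves up; the paths
of the second kind have the same continuations as the paths of length `m` ending at `j + 1`. -/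
lemma cylMeasure_eq_add {ν : Measure BInfty.PathSpace} (hν : BInfty.TailInvariant ν) (m : ℕ)
    (j : ℕ+) : cylMeasure ν m j = cylMeasure ν (m + 1) j + cylMeasure ν m (j + 1) := by
  rw [cylMeasure_eq_tsum hν m j, cylMeasure_eq_tsum hν m (j + 1),
    ENNReal.tsum_eq_add_tsum_ite j, if_pos le_rfl]
  congr 1
  refine tsum_congr fun k => ?_
  rcases lt_trichotomy j k with h | rfl | h
  · rw [if_neg h.ne', if_pos h.le, if_pos (PNat.add_one_le_iff.2 h)]
  · rw [if_pos rfl, if_neg (PNat.lt_add_right j 1).not_ge]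
  · rw [if_neg h.ne, if_neg h.not_ge, if_neg (h.trans (PNat.lt_add_right j 1)).not_ge]

/-! ### Two shifts of a tail invariant measure -/

lemma measurable_of_take_eq_take {f : BInfty.PathSpace → BInfty.PathSpace}
    (h : ∀ n, ∃ k, ∀ x y : BInfty.PathSpace, x.take k = y.take k →
      (f x).take n = (f y).take n) : Measurable f := by
  refine measurable_of_take fun m e => ?_
  obtain ⟨k, hk⟩ := h m
  exact measurableSet_of_take k _ fun x y hxy hx => (hk x y hxy).symm.trans hx

/-- Translation of a path by `-1`, with the vertex `1` fixed. -/
def lower (x : BInfty.PathSpace) : BInfty.PathSpace :=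
  ofMonotone (fun n => vertex x n - 1) fun i k hik => by
    have h : (vertex x i : ℕ) ≤ vertex x k := monotone_vertex x hik
    simp only [← PNat.coe_le_coe, PNat.sub_coe, ← PNat.coe_lt_coe, PNat.one_coe]
    split_ifs <;> omega

/-- Translation of a path by `1`. -/
def raise (x : BInfty.PathSpace) : BInfty.PathSpace :=
  ofMonotone (fun n => vertex x n + 1) fun _ _ hik => add_le_add_left (monotone_vertex x hik) 1

/-- The path without its first edge. -/
def tail (x : BInfty.PathSpace) : BInfty.PathSpace :=
  ofMonotone (fun n => vertex x (n + 1)) fun _ _ hik => monotone_vertex x (by omega)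

/-- The path preceded by an edge from the vertex `1`. -/
def consOne (x : BInfty.PathSpace) : BInfty.PathSpace :=
  ofMonotone (fun n => Nat.casesOn n 1 (vertex x)) (monotone_nat_of_le_succ fun n => by
    cases n with
    | zero => exact one_le
    | succ n => exact monotone_vertex x n.le_succ)

lemma measurable_lower : Measurable lower := by
  refine measurable_of_take_eq_take fun n => ⟨n, fun x y hxy => ?_⟩
  rw [take_eq_take_iff] at hxy ⊢
  exact fun i hi => congrArg (· - 1) (hxy i hi)

lemma measurable_tail : Measurable tail := by
  refine measurable_of_take_eq_take fun n => ⟨n + 1, fun x y hxy => ?_⟩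
  rw [take_eq_take_iff] at hxy ⊢
  exact fun i hi => hxy (i + 1) (by omega)

/-- The translate by `-1` of the part of `ν` on paths that avoid the vertex `1`. -/
noncomputable def lowerMeasure (ν : Measure BInfty.PathSpace) : Measure BInfty.PathSpace :=
  (ν.restrict {x | vertex x 0 ≠ 1}).map lower

/-- The image of the part of `ν` on paths starting at the vertex `1` under deletion of the first
edge. -/
noncomputable def tailMeasure (ν : Measure BInfty.PathSpace) : Measure BInfty.PathSpace :=
  (ν.restrict {x | vertex x 0 = 1}).map tail

lemma lowerMeasure_cylinder {ν : Measure BInfty.PathSpace} (hν : BInfty.TailInvariant ν) (m : ℕ)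
    (e : BInfty.FinPath m) : lowerMeasure ν e.cylinder = cylMeasure ν m (endpoint e + 1) := by
  obtain ⟨p, rfl⟩ := exists_take_eq e
  rw [lowerMeasure, Measure.map_apply measurable_lower (FinPath.measurableSet_cylinder _),
    Measure.restrict_apply (measurable_lower (FinPath.measurableSet_cylinder _))]
  have : lower ⁻¹' (p.take m).cylinder ∩ {x | vertex x 0 ≠ 1} = ((raise p).take m).cylinder := by
    ext x
    rw [Set.mem_inter_iff, Set.mem_preimage, mem_cylinder_take, mem_cylinder_take]
    change (∀ i ≤ m, vertex x i - 1 = vertex p i) ∧ vertex x 0 ≠ 1 ↔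
      ∀ i ≤ m, vertex x i = vertex p i + 1
    constructor
    · rintro ⟨h, h₀⟩ i hi
      have h₁ : 1 < vertex x i :=
        (one_le (a := vertex x 0)).lt_of_ne' h₀ |>.trans_le (monotone_vertex x (Nat.zero_le i))
      rw [← h i hi, PNat.sub_add_of_lt h₁]
    · refine fun h => ⟨fun i hi => by rw [h i hi, PNat.add_sub], ?_⟩
      rw [h 0 (Nat.zero_le m)]
      exact (one_le.trans_lt (PNat.lt_add_right _ 1)).ne'
  rw [this, measure_cylinder hν, endpoint_take, endpoint_take]
  rfl

lemma tailMeasure_cylinder {ν : Measure BInfty.PathSpace} (hν : BInfty.TailInvariant ν) (m : ℕ)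
    (e : BInfty.FinPath m) : tailMeasure ν e.cylinder = cylMeasure ν (m + 1) (endpoint e) := by
  obtain ⟨p, rfl⟩ := exists_take_eq e
  rw [tailMeasure, Measure.map_apply measurable_tail (FinPath.measurableSet_cylinder _),
    Measure.restrict_apply (measurable_tail (FinPath.measurableSet_cylinder _))]
  have : tail ⁻¹' (p.take m).cylinder ∩ {x | vertex x 0 = 1} =
      ((consOne p).take (m + 1)).cylinder := by
    ext x
    rw [Set.mem_inter_iff, Set.mem_preimage, mem_cylinder_take, mem_cylinder_take]
    constructor
    · rintro ⟨h, h₀⟩ i hi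
      cases i with
      | zero => exact h₀
      | succ i => exact h i (by omega)
    · exact fun h => ⟨fun i hi => h (i + 1) (by omega), h 0 (Nat.zero_le _)⟩
  rw [this, measure_cylinder hν, endpoint_take, endpoint_take]
  rfl

/-- Raising the terminal vertex of a path by one multiplies the weight of an ergodic measure by a
constant: `cylMeasure_eq_add` exhibits the measure as a sum of two tail invariant measures, and
both summands are multiples of it by extremality. -/
lemma exists_cylMeasure_succ {ν : Measure BInfty.PathSpace} [IsFiniteMeasure ν]
    (hν : BInfty.TailInvariant ν) (herg : BInfty.TailErgodic ν) :
    ∃ c, ∀ m j, cylMeasure ν m (j + 1) = c * cylMeasure ν m j := by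
  have hsum : ν = tailMeasure ν + lowerMeasure ν := by
    refine measure_ext_of_cylinder (fun _ => measure_ne_top _ _) fun m e => ?_
    rw [Measure.add_apply, tailMeasure_cylinder hν, lowerMeasure_cylinder hν, measure_cylinder hν,
      cylMeasure_eq_add hν]
  have hle : lowerMeasure ν ≤ ν := by
    conv_rhs => rw [hsum]
    exact Measure.le_add_left le_rfl
  have hinv := tailInvariant_of_measure_cylinder (fun m j => cylMeasure ν m (j + 1))
    (lowerMeasure_cylinder hν)
  obtain ⟨c, hc⟩ := herg.eq_smul_of_le hν hinv hle
  refine ⟨c, fun m j => ?_⟩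
  have h := lowerMeasure_cylinder hν m ((constPath j).take m)
  rw [endpoint_take, vertex_constPath] at h
  rw [← h, hc]
  rfl

/-! ### Bounded harmonic functions of the Bernoulli walk on the quadrant -/

/-- The maximum of the difference `h m (s + 1) - h (m + 1) s`, itself harmonic, would be almost
attained along a whole long antidiagonal if it were positive, and the sum of these differences
along an antidiagonal telescopes to a difference of two values of `h`. -/
lemma harmonic_le {p q : ℝ} (hp : 0 < p) (hq : 0 < q) (hpq : p + q = 1) {h : ℕ → ℕ → ℝ}
    (h0 : ∀ m s, 0 ≤ h m s) (h1 : ∀ m s, h m s ≤ 1)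
    (hh : ∀ m s, h m s = p * h (m + 1) s + q * h m (s + 1)) (m s : ℕ) :
    h m (s + 1) ≤ h (m + 1) s := by
  set D : ℕ → ℕ → ℝ := fun m s => h m (s + 1) - h (m + 1) s
  have hDh : ∀ m s, D m s = p * D (m + 1) s + q * D m (s + 1) := by
    intro m s
    simp only [D]
    linear_combination hh m (s + 1) - hh (m + 1) s
  have hbdd : BddAbove (Set.range fun x : ℕ × ℕ => D x.1 x.2) := by
    refine ⟨1, ?_⟩
    rintro _ ⟨x, rfl⟩
    simp only [D]
    linarith [h0 (x.1 + 1) x.2, h1 x.1 (x.2 + 1)]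
  set M := ⨆ x : ℕ × ℕ, D x.1 x.2
  have hM : ∀ m s, D m s ≤ M := fun m s => le_ciSup hbdd (m, s)
  suffices M ≤ 0 by linarith [hM m s, show D m s = h m (s + 1) - h (m + 1) s from rfl]
  by_contra! hMpos
  -- Being `ε`-close to the maximum propagates, with a loss of a constant factor in each step.
  set r := min p q
  have hr : 0 < r := lt_min hp hq
  have hstep : ∀ ε, 0 ≤ ε → ∀ m s, M - ε ≤ D m s →
      M - ε / r ≤ D (m + 1) s ∧ M - ε / r ≤ D m (s + 1) := by
    intro ε hε m s hD
    have e₁ : ε / p ≤ ε / r := div_le_div_of_nonneg_left hε hr (min_le_left _ _)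
    have e₂ : ε / q ≤ ε / r := div_le_div_of_nonneg_left hε hr (min_le_right _ _)
    have a₁ : p * (M - ε / p) ≤ p * D (m + 1) s := by
      have : p * (ε / p) = ε := mul_div_cancel₀ ε hp.ne'
      nlinarith [hDh m s, mul_le_mul_of_nonneg_left (hM m (s + 1)) hq.le]
    have a₂ : q * (M - ε / q) ≤ q * D m (s + 1) := by
      have : q * (ε / q) = ε := mul_div_cancel₀ ε hq.ne'
      nlinarith [hDh m s, mul_le_mul_of_nonneg_left (hM (m + 1) s) hp.le]
    constructor
    · linarith [le_of_mul_le_mul_left a₁ hp]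
    · linarith [le_of_mul_le_mul_left a₂ hq]
  have hprop : ∀ k l : ℕ, ∀ ε, 0 ≤ ε → ∀ m s, M - ε ≤ D m s →
      M - ε / r ^ (k + l) ≤ D (m + k) (s + l) := by
    intro k l ε hε m s hD
    have hk : M - ε / r ^ k ≤ D (m + k) s := by
      induction k with
      | zero => simpa using hD
      | succ k ih =>
        rw [pow_succ, ← div_div]
        exact (hstep _ (by positivity) _ _ ih).1
    induction l with
    | zero => simpa using hk
    | succ l ih =>
      rw [← add_assoc k, pow_succ, ← div_div]
      exact (hstep _ (by positivity) _ _ ih).2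
  obtain ⟨n, hn⟩ := exists_nat_gt (2 / M)
  obtain ⟨⟨m₀, s₀⟩, hms⟩ := exists_lt_of_lt_ciSup
    (show M - r ^ n * (M / 2) < ⨆ x : ℕ × ℕ, D x.1 x.2 from sub_lt_self _ (by positivity))
  have hbig : ∀ k ∈ Finset.range (n + 1), M / 2 ≤ D (m₀ + k) (s₀ + (n - k)) := by
    intro k hk
    have hkn : k + (n - k) = n := by
      have := Finset.mem_range.1 hk
      omega
    have := hprop k (n - k) _ (by positivity) m₀ s₀ hms.le
    rw [hkn, mul_div_cancel_left₀ _ (by positivity : r ^ n ≠ 0)] at this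
    linarith
  have htel : ∑ k ∈ Finset.range (n + 1), D (m₀ + k) (s₀ + (n - k)) =
      h m₀ (s₀ + (n + 1)) - h (m₀ + (n + 1)) s₀ := by
    have := Finset.sum_range_sub' (fun k => h (m₀ + k) (s₀ + (n + 1 - k))) (n + 1)
    simp only [Nat.sub_self, Nat.sub_zero, add_zero] at this
    rw [← this]
    refine Finset.sum_congr rfl fun k hk => ?_
    have hk' := Finset.mem_range.1 hk
    simp only [D]
    rw [show s₀ + (n - k) + 1 = s₀ + (n + 1 - k) by omega,
      show n + 1 - (k + 1) = n - k by omega, add_assoc m₀]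
  have hsum := Finset.card_nsmul_le_sum _ _ _ hbig
  rw [htel, Finset.card_range, nsmul_eq_mul] at hsum
  rw [div_lt_iff₀ hMpos] at hn
  push_cast at hsum
  linarith [h0 (m₀ + (n + 1)) s₀, h1 m₀ (s₀ + (n + 1))]

/-- A bounded space-time harmonic function of the Bernoulli walk is constant. -/
lemma harmonic_eq_const {p q : ℝ} (hp : 0 < p) (hq : 0 < q) (hpq : p + q = 1) {h : ℕ → ℕ → ℝ}
    (h0 : ∀ m s, 0 ≤ h m s) (h1 : ∀ m s, h m s ≤ 1)
    (hh : ∀ m s, h m s = p * h (m + 1) s + q * h m (s + 1)) (m s : ℕ) : h m s = h 0 0 := by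
  have heq : ∀ m s, h m (s + 1) = h (m + 1) s := fun m s =>
    (harmonic_le hp hq hpq h0 h1 hh m s).antisymm <|
      harmonic_le (h := fun m s => h s m) hq hp (by linarith) (fun m s => h0 s m)
        (fun m s => h1 s m) (fun m s => by rw [hh s m]; ring) s m
  have h₁ : ∀ m s, h (m + 1) s = h m s := by
    intro m s
    have := hh m s
    rw [heq, ← add_mul, hpq, one_mul] at this
    exact this.symm
  have h₂ : ∀ m s, h m (s + 1) = h m s := fun m s => (heq m s).trans (h₁ m s)
  have h₃ : h m s = h m 0 := by
    induction s with
    | zero => rfl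
    | succ s ih => rw [h₂, ih]
  rw [h₃]
  clear h₃
  induction m with
  | zero => rfl
  | succ m ih => rw [h₁, ih]

/-! ### The measures with geometric increments -/

/-- The prescribed measure of a cylinder set of a path with `m` edges ending at `j`. -/
noncomputable def weight (a : ℝ) (m : ℕ) (j : ℕ+) : ℝ :=
  a ^ ((j : ℕ) - 1) / ((1 + a) ^ m * (1 + a) ^ (j : ℕ))

lemma weight_pos {a : ℝ} (ha : 0 < a) (m : ℕ) (j : ℕ+) : 0 < weight a m j := by
  rw [weight]
  positivity

/-- The weight is that of `m + 1` successes and `j - 1` failures in a Bernoulli scheme. -/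
lemma weight_succPNat {a : ℝ} (ha : 0 < a) (m s : ℕ) :
    weight a m s.succPNat = (1 - 1 / (1 + a)) ^ s * (1 / (1 + a)) ^ (m + 1) := by
  have h : 1 - 1 / (1 + a) = a / (1 + a) := by
    field_simp
    ring
  rw [weight, h, Nat.succPNat_coe, Nat.succ_eq_add_one, Nat.add_sub_cancel, div_pow,
    div_pow, one_pow]
  field_simp
  ring

/-- The path whose vertex at level `n`, diminished by `1`, is the partial sum `d 0 + ⋯ + d n`. -/
def walk (d : ℕ → ℕ) : BInfty.PathSpace :=
  ofMonotone (fun n => (∑ i ∈ Finset.range (n + 1), d i).succPNat)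
    (monotone_nat_of_le_succ fun n => by
      rw [Nat.succPNat_le_succPNat, Finset.sum_range_succ _ (n + 1)]
      exact Nat.le_add_right _ _)

lemma exists_walk_eq (x : BInfty.PathSpace) : ∃ d, walk d = x := by
  refine ⟨fun n => Nat.casesOn n (vertex x 0).natPred
    fun n => (vertex x (n + 1)).natPred - (vertex x n).natPred, ?_⟩
  set d : ℕ → ℕ := fun n => Nat.casesOn n (vertex x 0).natPred
    fun n => (vertex x (n + 1)).natPred - (vertex x n).natPred with hd
  have hsum : ∀ n, ∑ i ∈ Finset.range (n + 1), d i = (vertex x n).natPred := by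
    intro n
    induction n with
    | zero => simp [hd]
    | succ n ih =>
      rw [Finset.sum_range_succ, ih]
      exact Nat.add_sub_of_le (PNat.natPred_monotone (monotone_vertex x n.le_succ))
  refine PathSpace.eq_of_take_of_le (m := 0) ?_ fun i _ => Subtype.ext ?_
  · rw [take_eq_take_iff]
    intro i _
    exact (congrArg Nat.succPNat (hsum i)).trans (PNat.succPNat_natPred _)
  · rw [edge_eq, edge_eq]
    exact Prod.ext ((congrArg Nat.succPNat (hsum i)).trans (PNat.succPNat_natPred _))
      ((congrArg Nat.succPNat (hsum (i + 1))).trans (PNat.succPNat_natPred _))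

lemma take_walk_eq_iff {d d' : ℕ → ℕ} {m : ℕ} :
    (walk d).take m = (walk d').take m ↔ ∀ i ∈ Finset.range (m + 1), d i = d' i := by
  have hv : ∀ (d : ℕ → ℕ) i, vertex (walk d) i = (∑ i ∈ Finset.range (i + 1), d i).succPNat :=
    fun _ _ => rfl
  simp only [take_eq_take_iff, hv, Nat.succPNat_inj]
  constructor
  · intro h i hi
    have him : i ≤ m := Nat.lt_succ_iff.1 (Finset.mem_range.1 hi)
    have h₁ := h i him
    cases i with
    | zero => simpa using h₁
    | succ i =>
      have h₂ := h i (by omega)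
      rw [Finset.sum_range_succ _ (i + 1), Finset.sum_range_succ _ (i + 1), h₂] at h₁
      exact Nat.add_left_cancel h₁
  · intro h i hi
    refine Finset.sum_congr rfl fun k hk => h k ?_
    simp only [Finset.mem_range] at hk ⊢
    omega

lemma preimage_walk_cylinder (d : ℕ → ℕ) (m : ℕ) :
    walk ⁻¹' ((walk d).take m).cylinder =
      Set.pi (Finset.range (m + 1) : Set ℕ) fun i => {d i} := by
  ext d'
  rw [Set.mem_preimage, FinPath.mem_cylinder, take_walk_eq_iff]
  rfl

lemma measurable_walk : Measurable walk := by
  refine measurable_of_take fun m e => ?_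
  obtain ⟨x, rfl⟩ := exists_take_eq e
  obtain ⟨d, rfl⟩ := exists_walk_eq x
  have := preimage_walk_cylinder d m
  rw [show {y | (walk y).take m = (walk d).take m} =
    walk ⁻¹' ((walk d).take m).cylinder from Set.ext fun _ => FinPath.mem_cylinder.symm, this]
  exact MeasurableSet.pi (Finset.countable_toSet _) fun _ _ => measurableSet_singleton _

/-- The success probability `1 / (1 + a)`. -/
noncomputable def successProb (a : Set.Ioi (0 : ℝ)) : unitInterval :=
  ⟨1 / (1 + (a : ℝ)), by
    have : (0 : ℝ) < a := a.2
    exact ⟨by positivity, by rw [div_le_one (by positivity)]; linarith⟩⟩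

/-- The law of the path whose initial vertex, diminished by `1`, and whose increments are
independent and geometrically distributed with success probability `1 / (1 + a)`. -/
noncomputable def geometricPathMeasure (a : Set.Ioi (0 : ℝ)) : Measure BInfty.PathSpace :=
  (Measure.infinitePi fun _ : ℕ => ProbabilityTheory.geometricMeasure (successProb a)).map walk

instance (a : Set.Ioi (0 : ℝ)) : IsProbabilityMeasure (geometricPathMeasure a) :=
  Measure.isProbabilityMeasure_map measurable_walk.aemeasurable

lemma geometricPathMeasure_cylinder (a : Set.Ioi (0 : ℝ)) (m : ℕ) (e : BInfty.FinPath m) :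
    geometricPathMeasure a e.cylinder = ENNReal.ofReal (weight a m (endpoint e)) := by
  obtain ⟨x, rfl⟩ := exists_take_eq e
  obtain ⟨d, rfl⟩ := exists_walk_eq x
  have ha : (0 : ℝ) < a := a.2
  have hp : successProb a ≠ 0 := by
    intro h
    have h' : 1 / (1 + (a : ℝ)) = 0 := congrArg Subtype.val h
    have : 0 < 1 / (1 + (a : ℝ)) := by positivity
    exact this.ne' h'
  rw [geometricPathMeasure,
    Measure.map_apply measurable_walk (FinPath.measurableSet_cylinder _), preimage_walk_cylinder,
    Measure.infinitePi_pi _ fun _ _ => measurableSet_singleton _, endpoint_take]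
  simp only [ProbabilityTheory.geometricMeasure_singleton hp]
  rw [← ENNReal.ofReal_prod_of_nonneg
    fun i _ => ProbabilityTheory.geometricMeasure_nonneg (successProb a) (d i),
    Finset.prod_mul_distrib, Finset.prod_pow_eq_pow_sum, Finset.prod_const, Finset.card_range]
  congr 1
  exact (weight_succPNat ha m _).symm

lemma cylMeasure_geometricPathMeasure (a : Set.Ioi (0 : ℝ)) (m : ℕ) (j : ℕ+) :
    cylMeasure (geometricPathMeasure a) m j = ENNReal.ofReal (weight a m j) :=
  cylMeasure_of_measure_cylinder (f := fun m j => ENNReal.ofReal (weight a m j))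
    (geometricPathMeasure_cylinder a) m j

lemma tailInvariant_geometricPathMeasure (a : Set.Ioi (0 : ℝ)) :
    BInfty.TailInvariant (geometricPathMeasure a) :=
  tailInvariant_of_measure_cylinder (fun m j => ENNReal.ofReal (weight a m j))
    (geometricPathMeasure_cylinder a)

lemma eq_geometricPathMeasure {a : Set.Ioi (0 : ℝ)} {ν : Measure BInfty.PathSpace}
    (h : ∀ (m : ℕ) (e : BInfty.FinPath m),
      ν e.cylinder = ENNReal.ofReal (weight a m (endpoint e))) :
    ν = geometricPathMeasure a :=
  measure_ext_of_cylinder (fun e => by rw [h]; exact ENNReal.ofReal_ne_top) fun m e => by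
    rw [h, geometricPathMeasure_cylinder]

lemma nullSingletonClass_geometricPathMeasure (a : Set.Ioi (0 : ℝ)) :
    NullSingletonClass (geometricPathMeasure a) := by
  have ha : (0 : ℝ) < a := a.2
  refine ⟨fun x => ?_⟩
  have hlim : Filter.Tendsto (fun m => ENNReal.ofReal ((1 / (1 + (a : ℝ))) ^ (m + 1)))
      Filter.atTop (nhds 0) := by
    rw [← ENNReal.ofReal_zero]
    refine (ENNReal.continuous_ofReal.tendsto 0).comp ?_
    refine (tendsto_pow_atTop_nhds_zero_of_lt_one (by positivity) ?_).comp
      (Filter.tendsto_add_atTop_nat 1)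
    rw [div_lt_one (by positivity)]
    linarith
  refine le_antisymm (ge_of_tendsto' hlim fun m => ?_) zero_le
  calc geometricPathMeasure a {x} ≤ geometricPathMeasure a (x.take m).cylinder :=
        measure_mono (Set.singleton_subset_iff.2 (FinPath.mem_cylinder.2 rfl))
    _ = ENNReal.ofReal (weight a m (vertex x m)) := by
        rw [geometricPathMeasure_cylinder, endpoint_take]
    _ ≤ _ := by
        refine ENNReal.ofReal_le_ofReal ?_
        rw [← PNat.succPNat_natPred (vertex x m), weight_succPNat ha]
        have h₁ : 0 < 1 / (1 + (a : ℝ)) := by positivity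
        have h₂ : 1 / (1 + (a : ℝ)) ≤ 1 := by
          rw [div_le_one (by positivity)]
          linarith
        exact mul_le_of_le_one_left (by positivity) (pow_le_one₀ (by linarith) (by linarith))

/-- A tail invariant measure dominated by `geometricPathMeasure a` is a multiple of it: the quotient
of the weights of the two measures is a bounded harmonic function. -/
lemma eq_smul_geometricPathMeasure {a : Set.Ioi (0 : ℝ)} {ρ : Measure BInfty.PathSpace}
    (hρ : BInfty.TailInvariant ρ) (hle : ρ ≤ geometricPathMeasure a) :
    ∃ c : ENNReal, ρ = c • geometricPathMeasure a := by
  have ha : (0 : ℝ) < a := a.2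
  have : IsFiniteMeasure ρ := isFiniteMeasure_of_le _ hle
  set p : ℝ := 1 / (1 + a) with hp
  have hp0 : 0 < p := by positivity
  have hp1 : p < 1 := by
    rw [hp, div_lt_one (by positivity)]
    linarith
  set w : ℕ → ℕ → ℝ := fun m s => weight a m s.succPNat with hw
  have hwpos : ∀ m s, 0 < w m s := fun m s => weight_pos ha _ _
  set h : ℕ → ℕ → ℝ := fun m s => (cylMeasure ρ m s.succPNat).toReal / w m s with hh
  have hfin : ∀ m j, cylMeasure ρ m j ≠ ⊤ := fun m j => measure_ne_top _ _
  have hharm : ∀ m s, h m s = p * h (m + 1) s + (1 - p) * h m (s + 1) := by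
    intro m s
    have e := congrArg ENNReal.toReal (cylMeasure_eq_add hρ m s.succPNat)
    rw [ENNReal.toReal_add (hfin _ _) (hfin _ _),
      show s.succPNat + 1 = (s + 1).succPNat from PNat.eq rfl] at e
    have w₁ : w (m + 1) s = p * w m s := by
      simp only [hw, weight_succPNat ha, ← hp]
      ring
    have w₂ : w m (s + 1) = (1 - p) * w m s := by
      simp only [hw, weight_succPNat ha, ← hp]
      ring
    have hq : 1 - p ≠ 0 := by linarith
    have := (hwpos m s).ne'
    simp only [hh]
    rw [e, w₁, w₂]
    field_simp
  have hconst := harmonic_eq_const (h := h) hp0 (sub_pos.2 hp1) (by ring)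
    (fun m s => div_nonneg ENNReal.toReal_nonneg (hwpos m s).le)
    (fun m s => by
      simp only [hh]
      rw [div_le_one (hwpos m s)]
      refine ENNReal.toReal_le_of_le_ofReal (hwpos m s).le ?_
      rw [hw, ← cylMeasure_geometricPathMeasure]
      exact hle _) hharm
  have hc : 0 ≤ h 0 0 := div_nonneg ENNReal.toReal_nonneg (hwpos 0 0).le
  refine ⟨ENNReal.ofReal (h 0 0), measure_ext_of_cylinder (fun _ => measure_ne_top _ _)
    fun m e => ?_⟩
  rw [Measure.smul_apply, smul_eq_mul, measure_cylinder hρ, geometricPathMeasure_cylinder,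
    ← ENNReal.ofReal_mul hc, ← PNat.succPNat_natPred (endpoint e), ← hconst m (endpoint e).natPred,
    ← ENNReal.ofReal_toReal (hfin _ _)]
  congr 1
  exact (div_mul_cancel₀ _ (hwpos m _).ne').symm

lemma tailErgodic_geometricPathMeasure (a : Set.Ioi (0 : ℝ)) :
    BInfty.TailErgodic (geometricPathMeasure a) := by
  intro A hA hsat
  obtain ⟨c, hc⟩ := eq_smul_geometricPathMeasure
    ((tailInvariant_geometricPathMeasure a).restrict hA hsat) Measure.restrict_le_self
  have h : c * geometricPathMeasure a Aᶜ = 0 := by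
    rw [← smul_eq_mul, ← Measure.smul_apply, ← hc, Measure.restrict_apply hA.compl,
      Set.compl_inter_self, measure_empty]
  rcases mul_eq_zero.1 h with rfl | h
  · left
    rw [← Measure.restrict_apply_self, hc, zero_smul]
    rfl
  · exact Or.inr h

/-! ### Classification of the ergodic measures -/

/-- If the cylinders of paths ending above the vertex `1` are null, the measure is concentrated on
the vertical path through `1`. -/
lemma measure_constPath_one {ν : Measure BInfty.PathSpace} [IsProbabilityMeasure ν]
    (hν : BInfty.TailInvariant ν) (h : ∀ m j, cylMeasure ν m (j + 1) = 0) :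
    ν {constPath 1} = 1 := by
  have h₀ : cylMeasure ν 0 1 = 1 := by
    have := tsum_cylMeasure_zero ν
    rw [measure_univ, tsum_eq_single 1] at this
    · exact this
    · intro j hj
      rw [← PNat.sub_add_of_lt (one_le.lt_of_ne' hj), h]
  have h₁ : ∀ m, cylMeasure ν m 1 = 1 := by
    intro m
    induction m with
    | zero => exact h₀
    | succ m ih => rw [← ih, cylMeasure_eq_add hν m 1, h, add_zero]
  have h₂ : ({constPath 1} : Set BInfty.PathSpace) =
      ⋂ m, ((constPath 1).take m).cylinder := by
    ext x
    simp only [Set.mem_singleton_iff, Set.mem_iInter, FinPath.mem_cylinder]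
    constructor
    · rintro rfl m
      rfl
    · exact fun hx => PathSpace.eq_of_take_of_le (hx 0) fun i _ =>
        (PathSpace.take_eq_take_iff.1 (hx (i + 1))).2 i i.lt_succ_self
  have h₃ : ∀ᵐ x ∂ν, ∀ m, x ∈ ((constPath 1).take m).cylinder := by
    rw [ae_all_iff]
    intro m
    exact (prob_compl_eq_zero_iff (FinPath.measurableSet_cylinder _)).2 (h₁ m)
  have h₄ : ν Set.univ ≤ ν {constPath 1} := by
    rw [h₂]
    refine measure_mono_ae ?_
    filter_upwards [h₃] with x hx _
    exact Set.mem_iInter.2 hx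
  exact le_antisymm prob_le_one (measure_univ (μ := ν) ▸ h₄)

/-- By `exists_cylMeasure_succ` the weights form a geometric sequence in the terminal vertex, and
`cylMeasure_eq_add` makes them one in the length of the path. -/
theorem exists_eq_geometricPathMeasure {ν : Measure BInfty.PathSpace} [IsProbabilityMeasure ν]
    [NullSingletonClass ν] (hν : BInfty.TailInvariant ν) (herg : BInfty.TailErgodic ν) :
    ∃ a, ν = geometricPathMeasure a := by
  obtain ⟨c, hc⟩ := exists_cylMeasure_succ hν herg
  have hpow : ∀ m s : ℕ, cylMeasure ν m s.succPNat = c ^ s * cylMeasure ν m 1 := by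
    intro m s
    induction s with
    | zero =>
      rw [pow_zero, one_mul]
      rfl
    | succ s ih =>
      rw [show (s + 1).succPNat = s.succPNat + 1 from PNat.eq rfl, hc, ih, pow_succ', mul_assoc]
  -- total mass `1` makes the ratio `c` less than `1` and determines the weight of the vertex `1`
  have htotal : (1 - c)⁻¹ * cylMeasure ν 0 1 = 1 := by
    rw [← ENNReal.tsum_geometric, ← ENNReal.tsum_mul_right, ← measure_univ (μ := ν),
      ← tsum_cylMeasure_zero, ← Equiv.pnatEquivNat.symm.tsum_eq]
    exact tsum_congr fun s => (hpow 0 s).symm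
  have hc1 : c < 1 := by
    by_contra! h
    rw [tsub_eq_zero_of_le h, ENNReal.inv_zero] at htotal
    rcases eq_or_ne (cylMeasure ν 0 1) 0 with h' | h'
    · rw [h', mul_zero] at htotal
      exact zero_ne_one htotal
    · rw [ENNReal.top_mul h'] at htotal
      exact ENNReal.top_ne_one htotal
  have hc0 : c ≠ 0 := by
    rintro rfl
    have := measure_constPath_one hν fun m j => by rw [hc, zero_mul]
    rw [measure_singleton] at this
    exact zero_ne_one this
  obtain ⟨t, ht0, rfl⟩ : ∃ t : ℝ, 0 < t ∧ c = ENNReal.ofReal t :=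
    ⟨c.toReal, ENNReal.toReal_pos hc0 hc1.ne_top, (ENNReal.ofReal_toReal hc1.ne_top).symm⟩
  have ht1 : t < 1 := ENNReal.ofReal_lt_one.1 hc1
  have hsub : 1 - ENNReal.ofReal t = ENNReal.ofReal (1 - t) := by
    rw [ENNReal.ofReal_sub _ ht0.le, ENNReal.ofReal_one]
  have hfin : ∀ m j, cylMeasure ν m j ≠ ⊤ := fun m j => measure_ne_top _ _
  have h₁ : ∀ m, cylMeasure ν m 1 = ENNReal.ofReal ((1 - t) ^ (m + 1)) := by
    intro m
    induction m with
    | zero =>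
      rw [zero_add, pow_one, ← hsub]
      rw [ENNReal.eq_inv_of_mul_eq_one_left ((mul_comm _ _).trans htotal), inv_inv]
    | succ m ih =>
      have e := cylMeasure_eq_add hν m 1
      rw [hc] at e
      have e' := ENNReal.eq_sub_of_add_eq (ENNReal.mul_ne_top hc1.ne_top (hfin m 1)) e.symm
      rw [e', ih, ← ENNReal.ofReal_mul ht0.le, ← ENNReal.ofReal_sub _ (by
        have := sub_pos.2 ht1
        positivity)]
      congr 1
      ring
  have ht : 0 < t / (1 - t) := div_pos ht0 (sub_pos.2 ht1)
  have ht' : 1 / (1 + t / (1 - t)) = 1 - t := by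
    have := sub_pos.2 ht1
    field_simp
    ring
  refine ⟨⟨t / (1 - t), ht⟩, eq_geometricPathMeasure fun m e => ?_⟩
  rw [measure_cylinder hν, ← PNat.succPNat_natPred (endpoint e), hpow, h₁, weight_succPNat ht, ht',
    ← ENNReal.ofReal_pow ht0.le, ← ENNReal.ofReal_mul (by positivity), sub_sub_cancel]

end BInfty

/-- The paths here start at level `0`, so a path with `m` edges ends at the `(m + 1)`-st level of
the diagram (`n = m + 1` when the levels are numbered from `1`). -/
theorem mainTheorem2 :
    ∃ μ : Set.Ioi (0 : ℝ) → Measure BInfty.PathSpace,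
      (∀ (a : Set.Ioi (0 : ℝ)) (m : ℕ) (j : ℕ+) (e : BInfty.FinPath m), e.range = j →
        μ a e.cylinder = ENNReal.ofReal
          ((a : ℝ) ^ ((j : ℕ) - 1) / ((1 + (a : ℝ)) ^ m * (1 + (a : ℝ)) ^ (j : ℕ)))) ∧
      (∀ (a : Set.Ioi (0 : ℝ)) (ν : Measure BInfty.PathSpace),
        (∀ (m : ℕ) (j : ℕ+) (e : BInfty.FinPath m), e.range = j →
          ν e.cylinder = ENNReal.ofReal
            ((a : ℝ) ^ ((j : ℕ) - 1) / ((1 + (a : ℝ)) ^ m * (1 + (a : ℝ)) ^ (j : ℕ)))) →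
        ν = μ a) ∧
      (∀ ν : Measure BInfty.PathSpace,
        (IsProbabilityMeasure ν ∧ NullSingletonClass ν ∧ BInfty.TailInvariant ν ∧ BInfty.TailErgodic ν) ↔
          ∃ a : Set.Ioi (0 : ℝ), ν = μ a) := by
  refine ⟨BInfty.geometricPathMeasure, ?_, ?_, fun ν => ⟨?_, ?_⟩⟩
  · rintro a m _ e rfl
    exact BInfty.geometricPathMeasure_cylinder a m e
  · exact fun a ν h => BInfty.eq_geometricPathMeasure fun m e => h m _ e rfl
  · rintro ⟨_, _, hν, herg⟩
    exact BInfty.exists_eq_geometricPathMeasure hν herg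
  · rintro ⟨a, rfl⟩
    exact ⟨inferInstance, BInfty.nullSingletonClass_geometricPathMeasure a,
      BInfty.tailInvariant_geometricPathMeasure a, BInfty.tailErgodic_geometricPathMeasure a⟩
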